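/- Consider a generalized linear model at a fixed coefficient vector $\beta\in\mathbb R^l$: for $x$ in the experimental region $\Omega\subseteq\mathbb R^d$ the response $Y(x)$ has mean $\mu(x)=h^{-1}(\beta^T g(x))$ and finite positive variance, where $g=(g_1,\dots,g_l)^T$ are the basis functions and $h$ is an (injective) link function that is differentiable at $\mu(x)$ with $h'(\mu(x))\neq 0$. Put $w(x)=1/\{\operatorname{Var}(Y(x))\,[h'(\mu(x))]^2\}$. Fix distinct design points $x_1,\dots,x_n\in\Omega$. For a weight vector $\lambda$ ($\lambda_i\ge 0$, $\sum_i\lambda_i=1$) let $$I(\xi^\lambda)=\sum_{i=1}^n\lambda_i\,w(x_i)\,g(x_i)g(x_i)^T$$ be the Fisher information matrix, and call $\lambda$ feasible if $I(\xi^\lambda)$ is invertible. Let $f=(f_1,\dots,f_q)^T:\mathbb R^l\to\mathbb R^q$ be differentiable at $\beta$ with Jacobian matrix $J=\partial f(\beta)/\partial\beta^T\neq 0$, let $B=J^TJ$, let $0<p<\infty$, and for feasible $\lambda$ let $$\Phi_p(\xi^\lambda)=\left(q^{-1}\operatorname{tr}\left[\left(J\,I(\xi^\lambda)^{-1}J^T\right)^p\right]\right)^{1/p}=\left(q^{-1}\operatorname{tr}\left[\left(I(\xi^\lambda)^{-1}B\right)^p\right]\right)^{1/p}.$$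 Here real powers of a matrix that is diagonalizable with nonnegative eigenvalues are taken eigenvalue by eigenvalue: $(S\operatorname{diag}(e_i)S^{-1})^r=S\operatorname{diag}(e_i^r)S^{-1}$, with $0^0=1$ and $0^r=0$ for $r<0$ (the value of $0^{r}$ for $r\le 0$ does not affect the expressions below). Let $\lambda^*$ be a feasible weight vector, and write $I=I(\xi^{\lambda^*})$. Then $\lambda^*$ minimizes $\Phi_p(\xi^\lambda)$ over all feasible weight vectors $\lambda$ if and only if $$\Phi_p(\xi^{\lambda^*})=q^{-1/p}\left[\operatorname{tr}\left(I^{-1}B\right)^p\right]^{1/p-1}w(x_i)\,g(x_i)^TI^{-1}B\left(I^{-1}B\right)^{p-1}I^{-1}g(x_i)\quad\text{for all } i \text{ with } \lambda_i^*>0,$$ and $$\Phi_p(\xi^{\lambda^*})\ge q^{-1/p}\left[\operatorname{tr}\left(I^{-1}B\right)^p\right]^{1/p-1}w(x_j)\,g(x_j)^TI^{-1}B\left(I^{-1}B\right)^{p-1}I^{-1}g(x_j)\quad\text{for all } j \text{ with } \lambda_j^*=0.$$ -/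

import Mathlib

open MeasureTheory ProbabilityTheory Matrix

noncomputable section

/-- A generalized linear model with `d` explanatory variables and `l` basis functions, at a given
coefficient vector `β`. The response at `x` has law `law x`, with mean
`h⁻¹ (βᵀ g x)`, where `h` is the link function, injective on the set `meanDomain` of admissible
means, and `h⁻¹` is its inverse on that set. The laws may be those of any exponential family
(normal, binomial, Poisson, gamma, ...); only a finite positive variance is required of them. -/
structure GLM (d l : ℕ) where
  /-- the experimental region `Ω` -/
  region : Set (Fin d → ℝ)
  /-- the basis functions `g = (g₁, …, g_l)` -/
  basis : (Fin d → ℝ) → Fin l → ℝ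
  /-- the regression coefficients `β` -/
  coeff : Fin l → ℝ
  /-- the link function `h` -/
  link : ℝ → ℝ
  meanDomain : Set ℝ
  link_injOn : Set.InjOn link meanDomain
  predictor_mem : ∀ x ∈ region, coeff ⬝ᵥ basis x ∈ link '' meanDomain
  /-- the law of the response `Y(x)` -/
  law : (Fin d → ℝ) → Measure ℝ
  law_prob : ∀ x ∈ region, IsProbabilityMeasure (law x)
  law_memLp : ∀ x ∈ region, MemLp id 2 (law x)
  law_mean : ∀ x ∈ region,
    ∫ y, y ∂(law x) = Function.invFunOn link meanDomain (coeff ⬝ᵥ basis x)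
  law_variance_pos : ∀ x ∈ region, 0 < variance id (law x)
  link_differentiableAt : ∀ x ∈ region, DifferentiableAt ℝ link (∫ y, y ∂(law x))
  link_deriv_ne_zero : ∀ x ∈ region, deriv link (∫ y, y ∂(law x)) ≠ 0

namespace GLM

variable {d l : ℕ}

/-- The mean response `μ(x) = h⁻¹(βᵀ g(x))`. -/
def mean (M : GLM d l) (x : Fin d → ℝ) : ℝ :=
  Function.invFunOn M.link M.meanDomain (M.coeff ⬝ᵥ M.basis x)

/-- `w(x) = 1 / (Var(Y(x)) h'(μ(x))²)`. -/
def w (M : GLM d l) (x : Fin d → ℝ) : ℝ :=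
  1 / (variance id (M.law x) * (deriv M.link (M.mean x)) ^ 2)

/-- The Fisher information matrix `∑ᵢ λᵢ w(xᵢ) g(xᵢ) g(xᵢ)ᵀ` of the design that puts weight
`lam i` on the point `x i`. -/
def fisherInfo {n : ℕ} (M : GLM d l) (x : Fin n → Fin d → ℝ) (lam : Fin n → ℝ) :
    Matrix (Fin l) (Fin l) ℝ :=
  ∑ i, (lam i * M.w (x i)) • vecMulVec (M.basis (x i)) (M.basis (x i))

/-- The weight vectors (nonnegative, with sum one) on the points `x` for which the Fisher
information matrix is invertible, so that the criterion is defined. -/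
def feasibleWeights {n : ℕ} (M : GLM d l) (x : Fin n → Fin d → ℝ) : Set (Fin n → ℝ) :=
  {lam | lam ∈ stdSimplex ℝ (Fin n) ∧ IsUnit (M.fisherInfo x lam)}

end GLM

/-- The real power `A ^ r` of a square matrix that is diagonalizable over `ℝ` with nonnegative
eigenvalues: the value at `A` of the polynomial that interpolates `t ↦ t ^ r` at the eigenvalues
of `A`. See `matrixRpow_conj_diagonal`. -/
def matrixRpow {m : ℕ} (A : Matrix (Fin m) (Fin m) ℝ) (r : ℝ) : Matrix (Fin m) (Fin m) ℝ :=
  Polynomial.aeval A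
    (Lagrange.interpolate A.charpoly.roots.toFinset id (fun t : ℝ => t ^ r))

/-- If `A = S diag(e) S⁻¹` then `A ^ r = S diag(e ^ r) S⁻¹`. -/
theorem matrixRpow_conj_diagonal {m : ℕ} (S : (Matrix (Fin m) (Fin m) ℝ)ˣ) (e : Fin m → ℝ)
    (r : ℝ) :
    matrixRpow (S.1 * diagonal e * S⁻¹.1) r = S.1 * diagonal (fun i => e i ^ r) * S⁻¹.1 := by
  have hpoly : ∀ Q : Polynomial ℝ,
      Polynomial.aeval (S.1 * diagonal e * S⁻¹.1) Q
        = S.1 * diagonal (fun i => Q.eval (e i)) * S⁻¹.1 := by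
    intro Q
    induction Q using Polynomial.induction_on' with
    | add a b ha hb =>
      rw [map_add, ha, hb, ← add_mul, ← mul_add, diagonal_add]
      simp
    | monomial k c =>
      rw [Polynomial.aeval_monomial, Units.conj_pow, diagonal_pow, ← Algebra.smul_def,
        ← smul_mul_assoc, ← mul_smul_comm, ← diagonal_smul]
      congr 3
      ext i
      simp
  unfold matrixRpow
  rw [hpoly]
  congr 3
  ext i
  have hi : e i ∈ (S.1 * diagonal e * S⁻¹.1).charpoly.roots.toFinset := by
    have hc : (S.1 * diagonal e * S⁻¹.1).charpoly = (diagonal e).charpoly := by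
      simp
    rw [hc, Multiset.mem_toFinset, Polynomial.mem_roots (Matrix.charpoly_monic _).ne_zero]
    simp only [Matrix.charpoly_diagonal, Polynomial.IsRoot, Polynomial.eval_prod]
    exact Finset.prod_eq_zero (Finset.mem_univ i) (by simp)
  simpa using Lagrange.eval_interpolate_at_node (fun t : ℝ => t ^ r)
    (Set.injOn_id _) hi

/-- The `q × l` Jacobian matrix `∂f(β)/∂βᵀ`. -/
def jacobianMatrix {l q : ℕ} (f : (Fin l → ℝ) → Fin q → ℝ) (β : Fin l → ℝ) :
    Matrix (Fin q) (Fin l) ℝ :=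
  LinearMap.toMatrix' (fderiv ℝ f β).toLinearMap

namespace GLM

variable {d l q n : ℕ}

/-- The criterion `Φ_p = (q⁻¹ tr [(J I⁻¹ Jᵀ) ^ p]) ^ (1/p)`, where `J = ∂f(β)/∂βᵀ` and `I` is the
Fisher information matrix. -/
def Phi (M : GLM d l) (f : (Fin l → ℝ) → Fin q → ℝ) (p : ℝ) (x : Fin n → Fin d → ℝ)
    (lam : Fin n → ℝ) : ℝ :=
  ((q : ℝ)⁻¹ * trace (matrixRpow
    (jacobianMatrix f M.coeff * (M.fisherInfo x lam)⁻¹ * (jacobianMatrix f M.coeff)ᵀ) p))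
      ^ (1 / p)

/-- `B = Jᵀ J`. -/
def B (M : GLM d l) (f : (Fin l → ℝ) → Fin q → ℝ) : Matrix (Fin l) (Fin l) ℝ :=
  (jacobianMatrix f M.coeff)ᵀ * jacobianMatrix f M.coeff

/-- `q^(-1/p) [tr (I⁻¹B)^p]^(1/p-1) w(xᵢ) g(xᵢ)ᵀ I⁻¹ B (I⁻¹B)^(p-1) I⁻¹ g(xᵢ)`. -/
def sensitivity (M : GLM d l) (f : (Fin l → ℝ) → Fin q → ℝ) (p : ℝ) (x : Fin n → Fin d → ℝ)
    (lam : Fin n → ℝ) (i : Fin n) : ℝ :=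
  (q : ℝ) ^ (-1 / p)
    * (trace (matrixRpow ((M.fisherInfo x lam)⁻¹ * M.B f) p)) ^ (1 / p - 1)
    * (M.w (x i) * (M.basis (x i) ⬝ᵥ
        (((M.fisherInfo x lam)⁻¹ * M.B f * matrixRpow ((M.fisherInfo x lam)⁻¹ * M.B f) (p - 1)
          * (M.fisherInfo x lam)⁻¹) *ᵥ M.basis (x i))))

end GLM

end

open Filter Topology

/-! ### Real powers of diagonalizable matrices -/

/-! Write ψ(H) = tr (J H⁻¹ Jᵀ)^p (`powTrace`) and let N(H) be `dualMatrix`. At feasible weights Φ_p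
is an increasing function of ψ, and each sensitivity is a fixed positive multiple of w(xᵢ) g(xᵢ)ᵀ N
g(xᵢ), so the claim concerns ψ and N.

Convexity enters as the tangent inequality (p+1) ψ(H) ≤ p tr(N(H) K) + ψ(K)
(`add_one_mul_powTrace_le`), together with tr(N(H) H) = ψ(H) (`trace_dualMatrix_mul_self`). It needs
no calculus: the eigenbases of J H⁻¹ Jᵀ and J K⁻¹ Jᵀ differ by an orthogonal P, Bessel's inequality
bounds the trace term below by a double sum over pairs of eigenvalues, AM-GM treats each pair, and
the squares of the entries of P are doubly stochastic.

Sufficiency: tr(N K) is the average of the sensitivities under the competing weights, so a bound by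
ψ(H) at every design point gives ψ(H) ≤ ψ(K). Necessity: move mass t to a design point and use the
tangent inequality at the perturbed matrix against the optimum; the bound holds for each t > 0 and
survives t → 0 (`dualMatrix_le_powTrace_of_tendsto`). Equality on the support follows because the
sensitivities average to ψ(H) under the optimal weights. -/

theorem aeval_conj_diagonal {m : ℕ} {A S T : Matrix (Fin m) (Fin m) ℝ} {e : Fin m → ℝ}
    (hTS : T * S = 1) (hA : A = S * diagonal e * T) (Q : Polynomial ℝ) :
    Polynomial.aeval A Q = S * diagonal (fun i => Q.eval (e i)) * T := by
  have hST : S * T = 1 := mul_eq_one_comm.mp hTS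
  have hpow : ∀ k : ℕ, A ^ k = S * diagonal (fun i => e i ^ k) * T := by
    intro k
    induction k with
    | zero => simp [hST]
    | succ k ih =>
      rw [pow_succ, ih, hA]
      calc S * diagonal (fun i => e i ^ k) * T * (S * diagonal e * T)
          = S * diagonal (fun i => e i ^ k) * (T * S) * diagonal e * T := by
            simp only [Matrix.mul_assoc]
        _ = _ := by
            rw [hTS, Matrix.mul_one, Matrix.mul_assoc S, diagonal_mul_diagonal]
            simp only [pow_succ]
  induction Q using Polynomial.induction_on' with
  | add a b ha hb =>
    rw [map_add, ha, hb, ← add_mul, ← mul_add, diagonal_add]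
    simp
  | monomial k c =>
    rw [Polynomial.aeval_monomial, hpow, ← Algebra.smul_def, ← smul_mul_assoc, ← mul_smul_comm,
      ← diagonal_smul]
    congr 3
    ext i
    simp

theorem matrixRpow_of_eq {m : ℕ} {A S T : Matrix (Fin m) (Fin m) ℝ} {e : Fin m → ℝ}
    (hTS : T * S = 1) (hA : A = S * diagonal e * T) (r : ℝ) :
    matrixRpow A r = S * diagonal (fun i => e i ^ r) * T := by
  have hST : S * T = 1 := mul_eq_one_comm.mp hTS
  rw [hA]
  exact matrixRpow_conj_diagonal ⟨S, T, hST, hTS⟩ e r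

/-- Any interpolant at the eigenvalues will do, so two matrices of different sizes can have their
powers computed by one polynomial. -/
theorem matrixRpow_eq_aeval {m : ℕ} {A S T : Matrix (Fin m) (Fin m) ℝ} {e : Fin m → ℝ}
    (hTS : T * S = 1) (hA : A = S * diagonal e * T) {r : ℝ} {Q : Polynomial ℝ}
    (hQ : ∀ i, Q.eval (e i) = e i ^ r) :
    matrixRpow A r = Polynomial.aeval A Q := by
  rw [matrixRpow_of_eq hTS hA, aeval_conj_diagonal hTS hA]
  simp only [hQ]

/-- A real symmetric positive semidefinite matrix has an orthogonal diagonalization. -/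
theorem exists_orthogonal_diagonalization {m : ℕ} {A : Matrix (Fin m) (Fin m) ℝ}
    (hA : A.PosSemidef) :
    ∃ (U : Matrix (Fin m) (Fin m) ℝ) (a : Fin m → ℝ),
      Uᵀ * U = 1 ∧ A = U * diagonal a * Uᵀ ∧ ∀ i, 0 ≤ a i := by
  refine ⟨hA.1.eigenvectorUnitary, hA.1.eigenvalues, ?_, ?_, hA.eigenvalues_nonneg⟩
  · have := Unitary.coe_star_mul_self hA.1.eigenvectorUnitary
    simpa [star_eq_conjTranspose] using this
  · have := hA.1.spectral_theorem
    rw [Unitary.conjStarAlgAut_apply] at this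
    simpa [star_eq_conjTranspose] using this

theorem posSemidef_mul_inv_mul_transpose {q l : ℕ} (J : Matrix (Fin q) (Fin l) ℝ)
    {H : Matrix (Fin l) (Fin l) ℝ} (hH : H.PosDef) : (J * H⁻¹ * Jᵀ).PosSemidef := by
  simpa using hH.inv.posSemidef.mul_mul_conjTranspose_same J

/-- `H⁻¹ Jᵀ J` is diagonalizable if `H` is positive definite. -/
theorem exists_diagonalization_inv_mul {q l : ℕ} (J : Matrix (Fin q) (Fin l) ℝ)
    {H : Matrix (Fin l) (Fin l) ℝ} (hH : H.PosDef) :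
    ∃ (S T : Matrix (Fin l) (Fin l) ℝ) (e : Fin l → ℝ),
      T * S = 1 ∧ H⁻¹ * (Jᵀ * J) = S * diagonal e * T := by
  -- With H⁻¹ = LᵀL, the matrix H⁻¹JᵀJ is conjugate by Lᵀ, whose inverse is LH, to the symmetric
  -- matrix L JᵀJ Lᵀ.
  obtain ⟨L, hL⟩ : ∃ L : Matrix (Fin l) (Fin l) ℝ, H⁻¹ = Lᵀ * L := by
    obtain ⟨U, a, -, hUa, ha⟩ := exists_orthogonal_diagonalization hH.inv.posSemidef
    refine ⟨diagonal (fun i => √(a i)) * Uᵀ, ?_⟩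
    rw [hUa, transpose_mul, diagonal_transpose, transpose_transpose, Matrix.mul_assoc,
      Matrix.mul_assoc, ← Matrix.mul_assoc (diagonal _) (diagonal _), diagonal_mul_diagonal]
    simp only [Real.mul_self_sqrt (ha _)]
  have hHu : H * H⁻¹ = 1 := mul_nonsing_inv _ ((isUnit_iff_isUnit_det _).mp hH.isUnit)
  have hR : H * Lᵀ * L = 1 := by rw [Matrix.mul_assoc, ← hL, hHu]
  have hR' : L * H * Lᵀ = 1 := by
    rw [Matrix.mul_assoc]; exact mul_eq_one_comm.mp hR
  have hR'' : Lᵀ * (L * H) = 1 := mul_eq_one_comm.mp hR'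
  have hpsd : (L * (Jᵀ * J) * Lᵀ).PosSemidef := by
    have h := posSemidef_self_mul_conjTranspose (L * Jᵀ)
    simpa [Matrix.mul_assoc] using h
  obtain ⟨W, e, hW, hWe, -⟩ := exists_orthogonal_diagonalization hpsd
  refine ⟨Lᵀ * W, Wᵀ * (L * H), e, ?_, ?_⟩
  · rw [Matrix.mul_assoc, ← Matrix.mul_assoc (L * H), hR', Matrix.one_mul, hW]
  · calc H⁻¹ * (Jᵀ * J) = Lᵀ * (L * (Jᵀ * J)) * (Lᵀ * (L * H)) := by
          rw [hR'', Matrix.mul_one, hL, Matrix.mul_assoc]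
      _ = Lᵀ * (L * (Jᵀ * J) * Lᵀ) * (L * H) := by simp only [Matrix.mul_assoc]
      _ = _ := by rw [hWe]; simp only [Matrix.mul_assoc]

/-- J(XJ)^k = (JX)^k J; this carries polynomial identities between the l × l and the q × q forms. -/
theorem aeval_mul_comm_rect {q l : ℕ} (X : Matrix (Fin l) (Fin q) ℝ) (J : Matrix (Fin q) (Fin l) ℝ)
    (Q : Polynomial ℝ) :
    J * Polynomial.aeval (X * J) Q = Polynomial.aeval (J * X) Q * J := by
  have hpow : ∀ k : ℕ, J * (X * J) ^ k = (J * X) ^ k * J := by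
    intro k
    induction k with
    | zero => simp
    | succ k ih =>
      rw [pow_succ, ← Matrix.mul_assoc, ih, pow_succ]
      simp only [Matrix.mul_assoc]
  induction Q using Polynomial.induction_on' with
  | add a b ha hb => rw [map_add, map_add, Matrix.mul_add, Matrix.add_mul, ha, hb]
  | monomial k c =>
    rw [Polynomial.aeval_monomial, Polynomial.aeval_monomial, ← Algebra.smul_def,
      ← Algebra.smul_def, Matrix.mul_smul, hpow, Matrix.smul_mul]

/-- Two finite families of nodes admit a common polynomial interpolating `t ↦ t ^ r`, which also
takes the value `0 ^ r` at `0`. -/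
theorem exists_common_interpolant {q l : ℕ} (a : Fin q → ℝ) (e : Fin l → ℝ) (r : ℝ) :
    ∃ Q : Polynomial ℝ, (∀ i, Q.eval (a i) = a i ^ r) ∧ (∀ i, Q.eval (e i) = e i ^ r) ∧
      Q.eval 0 = (0 : ℝ) ^ r := by
  classical
  let s : Finset ℝ := insert 0 (Finset.univ.image a ∪ Finset.univ.image e)
  have h : ∀ t ∈ s, (Lagrange.interpolate s id (fun t : ℝ => t ^ r)).eval t = t ^ r := by
    intro t ht
    simpa using Lagrange.eval_interpolate_at_node (fun t : ℝ => t ^ r) (Set.injOn_id _) ht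
  exact ⟨_, fun i => h _ (by simp [s]), fun i => h _ (by simp [s]), h _ (by simp [s])⟩

theorem matrixRpow_inv_mul_sandwich {q l : ℕ} (J : Matrix (Fin q) (Fin l) ℝ)
    {H : Matrix (Fin l) (Fin l) ℝ} (hH : H.PosDef) (r : ℝ) :
    H⁻¹ * (Jᵀ * J) * matrixRpow (H⁻¹ * (Jᵀ * J)) r * H⁻¹
      = H⁻¹ * Jᵀ * matrixRpow (J * H⁻¹ * Jᵀ) r * J * H⁻¹ := by
  obtain ⟨S, T, e, hTS, hST⟩ := exists_diagonalization_inv_mul J hH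
  obtain ⟨U, a, hU, hUa, -⟩ :=
    exists_orthogonal_diagonalization (posSemidef_mul_inv_mul_transpose J hH)
  obtain ⟨Q, hQa, hQe, -⟩ := exists_common_interpolant a e r
  rw [matrixRpow_eq_aeval hTS hST hQe, matrixRpow_eq_aeval hU hUa hQa]
  have h := aeval_mul_comm_rect (H⁻¹ * Jᵀ) J Q
  simp only [Matrix.mul_assoc] at h ⊢
  rw [← Matrix.mul_assoc J (Polynomial.aeval _ _), h]
  simp only [Matrix.mul_assoc]

theorem trace_matrixRpow_inv_mul {q l : ℕ} (J : Matrix (Fin q) (Fin l) ℝ)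
    {H : Matrix (Fin l) (Fin l) ℝ} (hH : H.PosDef) {p : ℝ} (hp : 0 < p) :
    trace (matrixRpow (H⁻¹ * (Jᵀ * J)) p) = trace (matrixRpow (J * H⁻¹ * Jᵀ) p) := by
  obtain ⟨S, T, e, hTS, hST⟩ := exists_diagonalization_inv_mul J hH
  obtain ⟨U, a, hU, hUa, -⟩ :=
    exists_orthogonal_diagonalization (posSemidef_mul_inv_mul_transpose J hH)
  obtain ⟨Q, hQa, hQe, hQ0⟩ := exists_common_interpolant a e p
  rw [matrixRpow_eq_aeval hTS hST hQe, matrixRpow_eq_aeval hU hUa hQa]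
  -- Since p > 0 the interpolant vanishes at 0; the factor X it splits off makes cyclicity of the
  -- trace applicable.
  obtain ⟨R, rfl⟩ : Polynomial.X ∣ Q := by
    rw [Polynomial.X_dvd_iff, Polynomial.coeff_zero_eq_eval_zero, hQ0, Real.zero_rpow hp.ne']
  have h := aeval_mul_comm_rect (H⁻¹ * Jᵀ) J R
  rw [map_mul, map_mul, Polynomial.aeval_X, Polynomial.aeval_X]
  simp only [Matrix.mul_assoc] at h ⊢
  rw [h, trace_mul_comm J]
  simp only [Matrix.mul_assoc]

/-! ### The trace criterion and its dual matrix -/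

/-- `tr [(J H⁻¹ Jᵀ) ^ p]`. -/
noncomputable def powTrace {q l : ℕ} (J : Matrix (Fin q) (Fin l) ℝ) (p : ℝ)
    (H : Matrix (Fin l) (Fin l) ℝ) : ℝ :=
  trace (matrixRpow (J * H⁻¹ * Jᵀ) p)

/-- `H⁻¹ Jᵀ (J H⁻¹ Jᵀ) ^ (p - 1) J H⁻¹`, which is up to a factor `-p` the gradient of `powTrace`
at `H`. -/
noncomputable def dualMatrix {q l : ℕ} (J : Matrix (Fin q) (Fin l) ℝ) (p : ℝ)
    (H : Matrix (Fin l) (Fin l) ℝ) : Matrix (Fin l) (Fin l) ℝ :=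
  H⁻¹ * Jᵀ * matrixRpow (J * H⁻¹ * Jᵀ) (p - 1) * J * H⁻¹

/-! ### Spectral formulas for the criterion and its dual matrix -/

section Spectral

variable {q l : ℕ} {J : Matrix (Fin q) (Fin l) ℝ} {H : Matrix (Fin l) (Fin l) ℝ}
  {U : Matrix (Fin q) (Fin q) ℝ} {a : Fin q → ℝ}

theorem powTrace_eq_sum (hU : Uᵀ * U = 1) (hUa : J * H⁻¹ * Jᵀ = U * diagonal a * Uᵀ) (p : ℝ) :
    powTrace J p H = ∑ i, a i ^ p := by
  rw [powTrace, matrixRpow_of_eq hU hUa, trace_mul_comm, ← Matrix.mul_assoc, hU, Matrix.one_mul,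
    trace_diagonal]

theorem dualMatrix_eq (hH : H.PosDef) (hU : Uᵀ * U = 1)
    (hUa : J * H⁻¹ * Jᵀ = U * diagonal a * Uᵀ) (p : ℝ) :
    dualMatrix J p H = (Uᵀ * J * H⁻¹)ᵀ * diagonal (fun i => a i ^ (p - 1)) * (Uᵀ * J * H⁻¹) := by
  have hs : (H⁻¹)ᵀ = H⁻¹ := by simpa using hH.inv.1.eq
  rw [dualMatrix, matrixRpow_of_eq hU hUa, transpose_mul, transpose_mul, transpose_transpose, hs]
  simp only [Matrix.mul_assoc]

theorem trace_dualMatrix_mul (hH : H.PosDef) (hU : Uᵀ * U = 1)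
    (hUa : J * H⁻¹ * Jᵀ = U * diagonal a * Uᵀ) (p : ℝ) (K : Matrix (Fin l) (Fin l) ℝ) :
    trace (dualMatrix J p H * K)
      = ∑ i, a i ^ (p - 1) * ((Uᵀ * J * H⁻¹) * K * (Uᵀ * J * H⁻¹)ᵀ) i i := by
  rw [dualMatrix_eq hH hU hUa, Matrix.mul_assoc, Matrix.mul_assoc, trace_mul_comm,
    Matrix.mul_assoc, trace]
  simp only [diag_apply, diagonal_mul]

theorem dotProduct_dualMatrix_mulVec (hH : H.PosDef) (hU : Uᵀ * U = 1)
    (hUa : J * H⁻¹ * Jᵀ = U * diagonal a * Uᵀ) (p : ℝ) (v : Fin l → ℝ) :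
    v ⬝ᵥ (dualMatrix J p H *ᵥ v) = ∑ i, a i ^ (p - 1) * ((Uᵀ * J * H⁻¹) *ᵥ v) i ^ 2 := by
  rw [dualMatrix_eq hH hU hUa, Matrix.mul_assoc, ← mulVec_mulVec, ← mulVec_mulVec,
    dotProduct_mulVec, vecMul_transpose, dotProduct]
  refine Finset.sum_congr rfl fun i _ => ?_
  rw [mulVec_diagonal]
  ring

/-- The rows of Uᵀ J H⁻¹ are orthogonal for the inner product H, with squared lengths a i: the
orthogonal system needed for Bessel's inequality. -/
theorem spectral_gram (hH : H.PosDef) (hU : Uᵀ * U = 1)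
    (hUa : J * H⁻¹ * Jᵀ = U * diagonal a * Uᵀ) :
    (Uᵀ * J * H⁻¹) * H * (Uᵀ * J * H⁻¹)ᵀ = diagonal a := by
  have hs : (H⁻¹)ᵀ = H⁻¹ := by simpa using hH.inv.1.eq
  have hHu : H⁻¹ * H = 1 := nonsing_inv_mul _ ((isUnit_iff_isUnit_det _).mp hH.isUnit)
  calc (Uᵀ * J * H⁻¹) * H * (Uᵀ * J * H⁻¹)ᵀ = Uᵀ * J * (H⁻¹ * H) * (H⁻¹ * Jᵀ * U) := by
        rw [transpose_mul, transpose_mul, hs, transpose_transpose]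
        simp only [Matrix.mul_assoc]
    _ = Uᵀ * (J * H⁻¹ * Jᵀ) * U := by rw [hHu, Matrix.mul_one]; simp only [Matrix.mul_assoc]
    _ = (Uᵀ * U) * diagonal a * (Uᵀ * U) := by rw [hUa]; simp only [Matrix.mul_assoc]
    _ = diagonal a := by rw [hU, Matrix.one_mul, Matrix.mul_one]

/-- An eigenvector of `J H⁻¹ Jᵀ` for the eigenvalue `0` lies in the kernel of `Jᵀ`. -/
theorem transpose_mul_row_eq_zero (hH : H.PosDef) (hU : Uᵀ * U = 1)
    (hUa : J * H⁻¹ * Jᵀ = U * diagonal a * Uᵀ) {i : Fin q} (hi : a i = 0) :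
    (Uᵀ * J) i = 0 := by
  by_contra hne
  have hpos := hH.inv.dotProduct_mulVec_pos hne
  have hd : (Uᵀ * J) * H⁻¹ * (Uᵀ * J)ᵀ = diagonal a := by
    calc (Uᵀ * J) * H⁻¹ * (Uᵀ * J)ᵀ = Uᵀ * (J * H⁻¹ * Jᵀ) * U := by
          rw [transpose_mul, transpose_transpose]; simp only [Matrix.mul_assoc]
      _ = (Uᵀ * U) * diagonal a * (Uᵀ * U) := by rw [hUa]; simp only [Matrix.mul_assoc]
      _ = diagonal a := by rw [hU, Matrix.one_mul, Matrix.mul_one]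
  have hii := congrFun (congrFun hd i) i
  rw [diagonal_apply_eq, hi] at hii
  have : (Uᵀ * J) i ⬝ᵥ (H⁻¹ *ᵥ (Uᵀ * J) i) = ((Uᵀ * J) * H⁻¹ * (Uᵀ * J)ᵀ) i i := by
    rw [Matrix.mul_assoc, Matrix.mul_apply_eq_vecMul, ← dotProduct_comm]
    simp [dotProduct, Matrix.mul_apply, vecMul, mulVec, mul_comm]
  rw [star_trivial, this, hii] at hpos
  exact lt_irrefl _ hpos

end Spectral

/-! ### The tangent inequality -/

section Criterion

variable {q l : ℕ} {J : Matrix (Fin q) (Fin l) ℝ} {H K : Matrix (Fin l) (Fin l) ℝ} {p : ℝ}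

theorem powTrace_nonneg (hH : H.PosDef) : 0 ≤ powTrace J p H := by
  obtain ⟨U, a, hU, hUa, ha⟩ :=
    exists_orthogonal_diagonalization (posSemidef_mul_inv_mul_transpose J hH)
  rw [powTrace_eq_sum hU hUa]
  exact Finset.sum_nonneg fun i _ => Real.rpow_nonneg (ha i) p

theorem powTrace_pos (hJ : J ≠ 0) (hH : H.PosDef) : 0 < powTrace J p H := by
  obtain ⟨U, a, hU, hUa, ha⟩ :=
    exists_orthogonal_diagonalization (posSemidef_mul_inv_mul_transpose J hH)
  rw [powTrace_eq_sum hU hUa]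
  have hex : ∃ i, a i ≠ 0 := by
    by_contra! h
    have h0 : Uᵀ * J = 0 := by
      ext i j
      exact congrFun (transpose_mul_row_eq_zero hH hU hUa (h i)) j
    apply hJ
    rw [← Matrix.one_mul J, ← mul_eq_one_comm.mp hU, Matrix.mul_assoc, h0, Matrix.mul_zero]
  obtain ⟨i, hi⟩ := hex
  exact Finset.sum_pos' (fun i _ => Real.rpow_nonneg (ha i) p)
    ⟨i, Finset.mem_univ i, Real.rpow_pos_of_pos ((ha i).lt_of_ne' hi) p⟩

/-- Euler's identity for ψ, which is homogeneous of degree -p. Zero eigenvalues contribute 0 on both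
sides, whatever the value of 0^(p-1). -/
theorem trace_dualMatrix_mul_self (hH : H.PosDef) (hp : 0 < p) :
    trace (dualMatrix J p H * H) = powTrace J p H := by
  obtain ⟨U, a, hU, hUa, ha⟩ :=
    exists_orthogonal_diagonalization (posSemidef_mul_inv_mul_transpose J hH)
  rw [powTrace_eq_sum hU hUa, trace_dualMatrix_mul hH hU hUa, spectral_gram hH hU hUa]
  refine Finset.sum_congr rfl fun i _ => ?_
  rw [diagonal_apply_eq]
  rcases (ha i).eq_or_lt with h | h
  · rw [← h, Real.zero_rpow hp.ne', mul_zero]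
  · rw [Real.rpow_sub_one h.ne', div_mul_cancel₀ _ h.ne']

/-- The scalar tangent inequality: AM-GM for a^(p+1)/c and c^p with weights p/(p+1) and 1/(p+1), in
which the powers of c cancel. -/
theorem add_one_mul_rpow_le {a c : ℝ} (hp : 0 < p) (ha : 0 ≤ a) (hc : 0 < c) :
    (p + 1) * a ^ p ≤ p * (a ^ (p - 1) * (c⁻¹ * a ^ 2)) + c ^ p := by
  have hp1 : (0 : ℝ) < p + 1 := by linarith
  rcases ha.eq_or_lt with rfl | ha
  · rw [Real.zero_rpow hp.ne']
    have := Real.rpow_nonneg hc.le p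
    simpa using this
  have h := Real.geom_mean_le_arith_mean2_weighted (w₁ := p / (p + 1)) (w₂ := 1 / (p + 1))
    (p₁ := a ^ (p + 1) * c⁻¹) (p₂ := c ^ p) (by positivity) (by positivity) (by positivity)
    (by positivity) (by field_simp)
  have e1 : (a ^ (p + 1) * c⁻¹) ^ (p / (p + 1)) * (c ^ p) ^ (1 / (p + 1)) = a ^ p := by
    rw [Real.mul_rpow (by positivity) (by positivity), ← Real.rpow_mul ha.le, Real.inv_rpow hc.le,
      ← Real.rpow_mul hc.le, mul_one_div, mul_div_cancel₀ _ hp1.ne', mul_assoc,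
      inv_mul_cancel₀ (Real.rpow_pos_of_pos hc _).ne', mul_one]
  have e2 : a ^ (p - 1) * (c⁻¹ * a ^ 2) = a ^ (p + 1) * c⁻¹ := by
    rw [Real.rpow_sub_one ha.ne', Real.rpow_add_one ha.ne']
    field_simp
  rw [e1] at h
  rw [e2]
  have h' := mul_le_mul_of_nonneg_left h hp1.le
  calc (p + 1) * a ^ p ≤ _ := h'
    _ = _ := by field_simp

theorem sum_sq_row_eq_one {P : Matrix (Fin q) (Fin q) ℝ} (hP : P * Pᵀ = 1) (j : Fin q) :
    ∑ i, P j i ^ 2 = 1 := by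
  have := congrFun (congrFun hP j) j
  simpa [Matrix.mul_apply, sq] using this

/-- Bessel's inequality for the inner product given by `K`, the rows of `F` being orthogonal. -/
theorem bessel_inequality (hK : K.PosDef) {F : Matrix (Fin q) (Fin l) ℝ} {c : Fin q → ℝ}
    (hF : F * K * Fᵀ = diagonal c) (E : Matrix (Fin q) (Fin l) ℝ) (i : Fin q) :
    ∑ j, (c j)⁻¹ * (F * K * Eᵀ) j i ^ 2 ≤ (E * K * Eᵀ) i i := by
  have hsK : Kᵀ = K := by simpa using hK.1.eq
  obtain ⟨G, hG⟩ : ∃ G, F * K * Eᵀ = G := ⟨_, rfl⟩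
  have hG' : E * K * Fᵀ = Gᵀ := by
    rw [← hG, transpose_mul, transpose_mul, transpose_transpose, hsK, Matrix.mul_assoc]
  obtain ⟨C, hC⟩ : ∃ C, diagonal (fun j => (c j)⁻¹) = C := ⟨_, rfl⟩
  -- As 0⁻¹ = 0, C is the pseudo-inverse of `diagonal c`, so zero-length rows of F need no
  -- exclusion.
  have hCC : C * diagonal c * C = C := by
    rw [← hC, diagonal_mul_diagonal, diagonal_mul_diagonal]
    congr 1
    ext j
    by_cases h : c j = 0
    · simp [h]
    · field_simp
  have hCt : Cᵀ = C := by rw [← hC, diagonal_transpose]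
  -- E - GᵀCF is E minus its K-orthogonal projection onto the rows of F.
  have hid : (E - Gᵀ * C * F) * K * (E - Gᵀ * C * F)ᵀ = E * K * Eᵀ - Gᵀ * C * G := by
    have h1 : (E - Gᵀ * C * F) * K * (E - Gᵀ * C * F)ᵀ
        = E * K * Eᵀ - (E * K * Fᵀ) * C * G - Gᵀ * C * (F * K * Eᵀ)
          + Gᵀ * (C * (F * K * Fᵀ) * C) * G := by
      rw [transpose_sub, transpose_mul, transpose_mul, transpose_transpose, hCt]
      simp only [Matrix.sub_mul, Matrix.mul_sub, Matrix.mul_assoc]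
      abel
    rw [h1, hG, hG', hF, hCC]
    abel
  have hpsd : ((E - Gᵀ * C * F) * K * (E - Gᵀ * C * F)ᵀ).PosSemidef := by
    simpa using hK.posSemidef.mul_mul_conjTranspose_same (E - Gᵀ * C * F)
  have hd := hpsd.diag_nonneg (i := i)
  rw [hid, Matrix.sub_apply, sub_nonneg] at hd
  refine le_trans (le_of_eq ?_) hd
  rw [Matrix.mul_apply]
  refine Finset.sum_congr rfl fun j _ => ?_
  rw [hG, ← hC, mul_diagonal, transpose_apply]
  ring

/-- A global lower bound for `powTrace J p K` that is affine in `K`, with equality at `K = H`. -/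
theorem add_one_mul_powTrace_le (hH : H.PosDef) (hK : K.PosDef) (hp : 0 < p) :
    (p + 1) * powTrace J p H ≤ p * trace (dualMatrix J p H * K) + powTrace J p K := by
  obtain ⟨U, a, hU, hUa, ha⟩ :=
    exists_orthogonal_diagonalization (posSemidef_mul_inv_mul_transpose J hH)
  obtain ⟨V, c, hV, hVc, hc⟩ :=
    exists_orthogonal_diagonalization (posSemidef_mul_inv_mul_transpose J hK)
  have hU' : U * Uᵀ = 1 := mul_eq_one_comm.mp hU
  have hsH : (H⁻¹)ᵀ = H⁻¹ := by simpa using hH.inv.1.eq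
  have hKu : K⁻¹ * K = 1 := nonsing_inv_mul _ ((isUnit_iff_isUnit_det _).mp hK.isUnit)
  rw [powTrace_eq_sum hU hUa, powTrace_eq_sum hV hVc, trace_dualMatrix_mul hH hU hUa]
  have hF := spectral_gram hK hV hVc
  set E := Uᵀ * J * H⁻¹ with hE
  set F := Vᵀ * J * K⁻¹ with hFdef
  set P := Vᵀ * U with hP
  have hG : F * K * Eᵀ = P * diagonal a := by
    calc F * K * Eᵀ = Vᵀ * J * (K⁻¹ * K) * (H⁻¹ * Jᵀ * U) := by
          rw [hE, hFdef, transpose_mul, transpose_mul, hsH, transpose_transpose]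
          simp only [Matrix.mul_assoc]
      _ = Vᵀ * (J * H⁻¹ * Jᵀ) * U := by rw [hKu, Matrix.mul_one]; simp only [Matrix.mul_assoc]
      _ = Vᵀ * U * diagonal a * (Uᵀ * U) := by rw [hUa]; simp only [Matrix.mul_assoc]
      _ = _ := by rw [hU, Matrix.mul_one]
  set G := P * diagonal a with hGdef
  have hGentry : ∀ j i, G j i = P j i * a i := fun j i => by rw [hGdef, mul_diagonal]
  have hbessel : ∀ i, ∑ j, (c j)⁻¹ * (P j i * a i) ^ 2 ≤ (E * K * Eᵀ) i i := by
    intro i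
    refine le_trans (le_of_eq (Finset.sum_congr rfl fun j _ => ?_)) (bessel_inequality hK hF E i)
    rw [hG, hGentry]
  -- AM-GM needs c j > 0; when c j = 0, row j of VᵀJ vanishes, and with it the whole pair term.
  have hzero : ∀ i j, c j = 0 → P j i * a i = 0 := by
    intro i j hj
    have hr := transpose_mul_row_eq_zero hK hV hVc hj
    have h2 : G = (Vᵀ * J) * (H⁻¹ * Jᵀ * U) := by
      rw [← hG, hE, hFdef, transpose_mul, transpose_mul, hsH, transpose_transpose]
      rw [Matrix.mul_assoc (Vᵀ * J), hKu, Matrix.mul_one, Matrix.mul_assoc H⁻¹]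
    rw [← hGentry, h2, Matrix.mul_apply]
    exact Finset.sum_eq_zero fun k _ => by rw [hr, Pi.zero_apply, zero_mul]
  have hterm : ∀ i j, (p + 1) * (a i ^ p * P j i ^ 2)
      ≤ p * (a i ^ (p - 1) * ((c j)⁻¹ * (P j i * a i) ^ 2)) + c j ^ p * P j i ^ 2 := by
    intro i j
    rcases (hc j).eq_or_lt with h | h
    · rw [hzero i j h.symm, ← h, Real.zero_rpow hp.ne']
      rcases mul_eq_zero.mp (hzero i j h.symm) with h0 | h0
      · simp [h0]
      · simp [h0, Real.zero_rpow hp.ne']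
    · have := mul_le_mul_of_nonneg_right (add_one_mul_rpow_le hp (ha i) h) (sq_nonneg (P j i))
      nlinarith [this]
  have hPP : P * Pᵀ = 1 := by
    rw [hP, transpose_mul, transpose_transpose, Matrix.mul_assoc, ← Matrix.mul_assoc U, hU',
      Matrix.one_mul, hV]
  have hrow : ∀ j, ∑ i, P j i ^ 2 = 1 := sum_sq_row_eq_one hPP
  have hcol : ∀ i, ∑ j, P j i ^ 2 = 1 := fun i =>
    sum_sq_row_eq_one (P := Pᵀ) (by rw [transpose_transpose]; exact mul_eq_one_comm.mp hPP) i
  calc (p + 1) * ∑ i, a i ^ p = ∑ i, ∑ j, (p + 1) * (a i ^ p * P j i ^ 2) := by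
        simp_rw [← Finset.mul_sum, hcol, mul_one]
    _ ≤ ∑ i, ∑ j, (p * (a i ^ (p - 1) * ((c j)⁻¹ * (P j i * a i) ^ 2)) + c j ^ p * P j i ^ 2) :=
        Finset.sum_le_sum fun i _ => Finset.sum_le_sum fun j _ => hterm i j
    _ = p * ∑ i, a i ^ (p - 1) * ∑ j, (c j)⁻¹ * (P j i * a i) ^ 2 + ∑ j, c j ^ p := by
        simp_rw [Finset.sum_add_distrib, ← Finset.mul_sum]
        congr 1
        rw [Finset.sum_comm]
        simp_rw [← Finset.mul_sum, hrow, mul_one]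
    _ ≤ _ := by
        gcongr with i
        · exact Real.rpow_nonneg (ha i) _
        · exact hbessel i

end Criterion

/-! ### Passage to the limit -/

section Limit

variable {q l : ℕ} {J : Matrix (Fin q) (Fin l) ℝ} {p : ℝ}

theorem isCompact_orthogonal (m : ℕ) :
    IsCompact {U : Matrix (Fin m) (Fin m) ℝ | Uᵀ * U = 1} := by
  have hbox : IsCompact (Set.univ.pi fun _ : Fin m => Set.univ.pi fun _ : Fin m =>
      Set.Icc (-1 : ℝ) 1) :=
    isCompact_univ_pi fun _ => isCompact_univ_pi fun _ => isCompact_Icc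
  refine IsCompact.of_isClosed_subset hbox ?_ ?_
  · exact isClosed_eq (by fun_prop) continuous_const
  · intro U hU i _ j _
    have hU' : U * Uᵀ = 1 := mul_eq_one_comm.mp hU
    have h1 := sum_sq_row_eq_one hU' i
    have h2 : U i j ^ 2 ≤ 1 := by
      rw [← h1]
      exact Finset.single_le_sum (f := fun j => U i j ^ 2) (fun _ _ => sq_nonneg _)
        (Finset.mem_univ j)
    exact abs_le.mp ((sq_le_one_iff_abs_le_one _).mp h2)

/-- Orthogonal diagonalizations of a convergent sequence of matrices converge along a subsequence
to a diagonalization of the limit. -/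
theorem exists_subseq_tendsto_diagonalization {A : Matrix (Fin q) (Fin q) ℝ}
    {As U : ℕ → Matrix (Fin q) (Fin q) ℝ} {a : ℕ → Fin q → ℝ} (hlim : Tendsto As atTop (𝓝 A))
    (hU : ∀ k, (U k)ᵀ * U k = 1) (hUa : ∀ k, As k = U k * diagonal (a k) * (U k)ᵀ) :
    ∃ (φ : ℕ → ℕ) (V : Matrix (Fin q) (Fin q) ℝ) (b : Fin q → ℝ), StrictMono φ ∧ Vᵀ * V = 1 ∧
      A = V * diagonal b * Vᵀ ∧ Tendsto (fun k => U (φ k)) atTop (𝓝 V) ∧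
      ∀ i, Tendsto (fun k => a (φ k) i) atTop (𝓝 (b i)) := by
  have : FirstCountableTopology (Matrix (Fin q) (Fin q) ℝ) :=
    inferInstanceAs (FirstCountableTopology (Fin q → Fin q → ℝ))
  obtain ⟨V, hV, φ, hφ, hUV⟩ := (isCompact_orthogonal q).tendsto_subseq hU
  have hV : Vᵀ * V = 1 := hV
  have hV' : V * Vᵀ = 1 := mul_eq_one_comm.mp hV
  have hUT : Tendsto (fun k => (U (φ k))ᵀ) atTop (𝓝 Vᵀ) :=
    (continuous_id.matrix_transpose.tendsto V).comp hUV
  have hdiag : Tendsto (fun k => (diagonal (a (φ k)) : Matrix (Fin q) (Fin q) ℝ)) atTop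
      (𝓝 (Vᵀ * A * V)) := by
    have h := (hUT.mul (hlim.comp hφ.tendsto_atTop)).mul hUV
    refine h.congr fun k => ?_
    simp only [Function.comp_apply, hUa]
    calc (U (φ k))ᵀ * (U (φ k) * diagonal (a (φ k)) * (U (φ k))ᵀ) * U (φ k)
        = ((U (φ k))ᵀ * U (φ k)) * diagonal (a (φ k)) * ((U (φ k))ᵀ * U (φ k)) := by
          simp only [Matrix.mul_assoc]
      _ = _ := by rw [hU, Matrix.one_mul, Matrix.mul_one]
  have hentry : ∀ i j, Tendsto (fun k => (diagonal (a (φ k)) : Matrix (Fin q) (Fin q) ℝ) i j) atTop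
      (𝓝 ((Vᵀ * A * V) i j)) := fun i j =>
    ((continuous_id.matrix_elem i j).tendsto _).comp hdiag
  have hVb : Vᵀ * A * V = diagonal fun i => (Vᵀ * A * V) i i := by
    ext i j
    by_cases h : i = j
    · subst h
      rw [diagonal_apply_eq]
    · have h0 := hentry i j
      simp only [diagonal_apply_ne _ h] at h0 ⊢
      exact tendsto_nhds_unique h0 tendsto_const_nhds
  refine ⟨φ, V, fun i => (Vᵀ * A * V) i i, hφ, hV, ?_, hUV, fun i => ?_⟩
  · rw [← hVb]
    calc A = (V * Vᵀ) * A * (V * Vᵀ) := by rw [hV', Matrix.one_mul, Matrix.mul_one]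
      _ = _ := by simp only [Matrix.mul_assoc]
  · simpa using hentry i i

theorem tendsto_transpose_mul_mul_mulVec {U : ℕ → Matrix (Fin q) (Fin q) ℝ}
    {V : Matrix (Fin q) (Fin q) ℝ} {X : ℕ → Matrix (Fin l) (Fin l) ℝ}
    {Y : Matrix (Fin l) (Fin l) ℝ} (hU : Tendsto U atTop (𝓝 V)) (hX : Tendsto X atTop (𝓝 Y))
    (v : Fin l → ℝ) (i : Fin q) :
    Tendsto (fun k => (((U k)ᵀ * J * X k) *ᵥ v) i) atTop (𝓝 (((Vᵀ * J * Y) *ᵥ v) i)) := by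
  have h : Continuous fun Z : Matrix (Fin q) (Fin q) ℝ × Matrix (Fin l) (Fin l) ℝ =>
      (Z.1ᵀ * J * Z.2) *ᵥ v :=
    ((continuous_fst.matrix_transpose.matrix_mul continuous_const).matrix_mul
      continuous_snd).matrix_mulVec continuous_const
  exact tendsto_pi_nhds.mp ((h.tendsto (V, Y)).comp (hU.prodMk_nhds hX)) i

/-- The inequality `vᵀ N(H) v ≤ tr [(J H⁻¹ Jᵀ) ^ p]`, where `N` is the dual matrix, is stable under
limits within the positive definite matrices. -/
theorem dualMatrix_le_powTrace_of_tendsto (hp : 0 < p) {H : Matrix (Fin l) (Fin l) ℝ}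
    (hH : H.PosDef) {Hs : ℕ → Matrix (Fin l) (Fin l) ℝ} (hHs : ∀ k, (Hs k).PosDef)
    (hlim : Tendsto Hs atTop (𝓝 H)) {v : Fin l → ℝ}
    (hle : ∀ k, v ⬝ᵥ (dualMatrix J p (Hs k) *ᵥ v) ≤ powTrace J p (Hs k)) :
    v ⬝ᵥ (dualMatrix J p H *ᵥ v) ≤ powTrace J p H := by
  choose U a hU hUa ha using fun k =>
    exists_orthogonal_diagonalization (posSemidef_mul_inv_mul_transpose J (hHs k))
  have hinv : Tendsto (fun k => (Hs k)⁻¹) atTop (𝓝 H⁻¹) := by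
    have hc : ContinuousAt Inv.inv H := by
      refine continuousAt_matrix_inv H ?_
      rw [Ring.inverse_eq_inv']
      exact continuousAt_inv₀ hH.det_pos.ne'
    exact hc.tendsto.comp hlim
  have hA : Tendsto (fun k => J * (Hs k)⁻¹ * Jᵀ) atTop (𝓝 (J * H⁻¹ * Jᵀ)) :=
    ((by fun_prop : Continuous fun X : Matrix (Fin l) (Fin l) ℝ => J * X * Jᵀ).tendsto _).comp hinv
  obtain ⟨φ, V, b, hφ, hV, hVb, hUV, hab⟩ := exists_subseq_tendsto_diagonalization hA hU hUa
  have hvec := tendsto_transpose_mul_mul_mulVec (J := J) hUV (hinv.comp hφ.tendsto_atTop) v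
  rw [dotProduct_dualMatrix_mulVec hH hV hVb, powTrace_eq_sum hV hVb]
  classical
  -- For p < 1, t^(p-1) is discontinuous at 0. Terms with limiting eigenvalue 0 vanish in the limit,
  -- and along the sequence they are nonnegative, so dropping them preserves the inequality.
  have hsupp : ∑ i, b i ^ (p - 1) * ((Vᵀ * J * H⁻¹) *ᵥ v) i ^ 2
      = ∑ i with b i ≠ 0, b i ^ (p - 1) * ((Vᵀ * J * H⁻¹) *ᵥ v) i ^ 2 := by
    refine (Finset.sum_subset (Finset.filter_subset _ _) fun i _ hi => ?_).symm
    have hi : b i = 0 := by simpa using hi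
    have hr := transpose_mul_row_eq_zero hH hV hVb hi
    have : ((Vᵀ * J * H⁻¹) *ᵥ v) i = 0 := by
      rw [← mulVec_mulVec]
      change (Vᵀ * J) i ⬝ᵥ _ = 0
      rw [hr, zero_dotProduct]
    rw [this]
    simp
  rw [hsupp]
  refine le_of_tendsto_of_tendsto' (b := atTop)
    (f := fun k => ∑ i with b i ≠ 0,
      a (φ k) i ^ (p - 1) * (((U (φ k))ᵀ * J * (Hs (φ k))⁻¹) *ᵥ v) i ^ 2)
    (g := fun k => ∑ i, a (φ k) i ^ p) (tendsto_finsetSum _ fun i hi => ?_)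
    (tendsto_finsetSum _ fun i _ => ?_) fun k => ?_
  · have hi : b i ≠ 0 := by simpa using hi
    exact ((hab i).rpow_const (Or.inl hi)).mul ((hvec i).pow 2)
  · exact (hab i).rpow_const (Or.inr hp.le)
  · have h := hle (φ k)
    rw [dotProduct_dualMatrix_mulVec (hHs _) (hU _) (hUa _), powTrace_eq_sum (hU _) (hUa _)] at h
    refine le_trans (Finset.sum_le_sum_of_subset_of_nonneg (Finset.filter_subset _ _) ?_) h
    exact fun i _ _ => mul_nonneg (Real.rpow_nonneg (ha _ i) _) (sq_nonneg _)

end Limit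

/-! ### Designs on finitely many points -/

namespace GLM

variable {d l q n : ℕ} (M : GLM d l) (x : Fin n → Fin d → ℝ)

theorem w_nonneg (y : Fin d → ℝ) : 0 ≤ M.w y :=
  one_div_nonneg.mpr (mul_nonneg (variance_nonneg _ _) (sq_nonneg _))

theorem posSemidef_smul_vecMulVec {c : ℝ} (hc : 0 ≤ c) (v : Fin l → ℝ) :
    (c • vecMulVec v v).PosSemidef := by
  simpa using (posSemidef_vecMulVec_self_star v).smul hc

theorem fisherInfo_posSemidef {lam : Fin n → ℝ} (h : ∀ i, 0 ≤ lam i) :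
    (M.fisherInfo x lam).PosSemidef :=
  posSemidef_sum _ fun i _ => posSemidef_smul_vecMulVec (mul_nonneg (h i) (M.w_nonneg _)) _

theorem fisherInfo_posDef {lam : Fin n → ℝ} (h : lam ∈ M.feasibleWeights x) :
    (M.fisherInfo x lam).PosDef :=
  (M.fisherInfo_posSemidef x h.1.1).posDef_iff_isUnit.mpr h.2

theorem trace_mul_fisherInfo (N : Matrix (Fin l) (Fin l) ℝ) (lam : Fin n → ℝ) :
    trace (N * M.fisherInfo x lam)
      = ∑ i, lam i * (M.w (x i) * (M.basis (x i) ⬝ᵥ (N *ᵥ M.basis (x i)))) := by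
  rw [fisherInfo, Matrix.mul_sum, trace_sum]
  refine Finset.sum_congr rfl fun i _ => ?_
  rw [Matrix.mul_smul, trace_smul, mul_vecMulVec, trace_vecMulVec, smul_eq_mul, mul_assoc,
    dotProduct_comm]

/-- Moving mass `t` to the point `i`. -/
theorem fisherInfo_lineMap (lam : Fin n → ℝ) (i : Fin n) (t : ℝ) :
    M.fisherInfo x ((1 - t) • lam + t • Pi.single i 1)
      = (1 - t) • M.fisherInfo x lam
        + t • (M.w (x i) • vecMulVec (M.basis (x i)) (M.basis (x i))) := by
  have h1 : M.w (x i) • vecMulVec (M.basis (x i)) (M.basis (x i))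
      = ∑ j, ((Pi.single i (1 : ℝ) : Fin n → ℝ) j * M.w (x j)) •
          vecMulVec (M.basis (x j)) (M.basis (x j)) := by
    rw [Finset.sum_eq_single i]
    · simp
    · intro j _ hj
      simp [hj]
    · simp
  rw [h1, fisherInfo, fisherInfo, Finset.smul_sum, Finset.smul_sum, ← Finset.sum_add_distrib]
  refine Finset.sum_congr rfl fun j _ => ?_
  rw [smul_smul, smul_smul, ← add_smul]
  congr 1
  simp only [Pi.add_apply, Pi.smul_apply, smul_eq_mul]
  ring

theorem fisherInfo_lineMap_posDef {lam : Fin n → ℝ} (h : lam ∈ M.feasibleWeights x) (i : Fin n)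
    {t : ℝ} (ht0 : 0 ≤ t) (ht1 : t < 1) :
    (M.fisherInfo x ((1 - t) • lam + t • Pi.single i 1)).PosDef := by
  rw [fisherInfo_lineMap]
  exact ((M.fisherInfo_posDef x h).smul (sub_pos.mpr ht1)).add_posSemidef
    ((posSemidef_smul_vecMulVec (M.w_nonneg _) _).smul ht0)

theorem lineMap_mem_feasibleWeights {lam : Fin n → ℝ} (h : lam ∈ M.feasibleWeights x) (i : Fin n)
    {t : ℝ} (ht0 : 0 ≤ t) (ht1 : t < 1) :
    (1 - t) • lam + t • Pi.single i 1 ∈ M.feasibleWeights x :=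
  ⟨convex_stdSimplex ℝ (Fin n) h.1 (single_mem_stdSimplex ℝ i) (sub_nonneg.mpr ht1.le) ht0
    (sub_add_cancel _ _), (M.fisherInfo_lineMap_posDef x h i ht0 ht1).isUnit⟩

/-- The equivalence theorem for the criterion `tr [(J I⁻¹ Jᵀ) ^ p]`. -/
theorem isMinOn_powTrace_iff (J : Matrix (Fin q) (Fin l) ℝ) {p : ℝ} (hp : 0 < p)
    {lam : Fin n → ℝ} (hlam : lam ∈ M.feasibleWeights x) :
    IsMinOn (fun mu => powTrace J p (M.fisherInfo x mu)) (M.feasibleWeights x) lam ↔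
      ∀ i, M.w (x i) * (M.basis (x i) ⬝ᵥ (dualMatrix J p (M.fisherInfo x lam) *ᵥ M.basis (x i)))
        ≤ powTrace J p (M.fisherInfo x lam) := by
  have hI := M.fisherInfo_posDef x hlam
  constructor
  · intro hmin i
    -- Absorbing √w into v makes the perturbation a pure rank-one term v vᵀ.
    obtain ⟨v, hv⟩ : ∃ v : Fin l → ℝ, v = √(M.w (x i)) • M.basis (x i) := ⟨_, rfl⟩
    have hquad : ∀ N : Matrix (Fin l) (Fin l) ℝ,
        v ⬝ᵥ (N *ᵥ v) = M.w (x i) * (M.basis (x i) ⬝ᵥ (N *ᵥ M.basis (x i))) := by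
      intro N
      rw [hv, mulVec_smul, smul_dotProduct, dotProduct_smul, smul_smul,
        Real.mul_self_sqrt (M.w_nonneg _), smul_eq_mul]
    rw [← hquad]
    let t : ℕ → ℝ := fun k => 1 / ((k : ℝ) + 2)
    have ht0 : ∀ k, 0 < t k := fun k => by positivity
    have ht1 : ∀ k, t k < 1 := fun k => by
      rw [div_lt_one (by positivity)]
      have : (0 : ℝ) ≤ k := k.cast_nonneg
      linarith
    have htlim : Tendsto t atTop (𝓝 0) :=
      tendsto_const_nhds.div_atTop (tendsto_atTop_add_const_right _ _ tendsto_natCast_atTop_atTop)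
    have hpd := fun k => M.fisherInfo_lineMap_posDef x hlam i (ht0 k).le (ht1 k)
    refine dualMatrix_le_powTrace_of_tendsto hp hI hpd ?_ fun k => ?_
    · simp only [fisherInfo_lineMap]
      have hc : Continuous fun s : ℝ => (1 - s) • M.fisherInfo x lam
          + s • (M.w (x i) • vecMulVec (M.basis (x i)) (M.basis (x i))) := by fun_prop
      simpa [Function.comp_def] using (hc.tendsto 0).comp htlim
    · have hle : powTrace J p (M.fisherInfo x lam) ≤ _ :=
        hmin (M.lineMap_mem_feasibleWeights x hlam i (ht0 k).le (ht1 k))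
      have hdual := add_one_mul_powTrace_le (J := J) (hpd k) hI hp
      have hself := trace_dualMatrix_mul_self (J := J) (hpd k) hp
      obtain ⟨N, hN⟩ : ∃ N, dualMatrix J p
        (M.fisherInfo x ((1 - t k) • lam + t k • Pi.single i 1)) = N := ⟨_, rfl⟩
      rw [hN] at hdual hself ⊢
      rw [fisherInfo_lineMap, Matrix.mul_add, Matrix.mul_smul, Matrix.mul_smul, Matrix.mul_smul,
        trace_add, trace_smul, trace_smul, trace_smul, mul_vecMulVec, trace_vecMulVec,
        dotProduct_comm, smul_eq_mul, smul_eq_mul, smul_eq_mul, ← hquad,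
        ← fisherInfo_lineMap] at hself
      simp only at hle
      obtain ⟨T, hT⟩ : ∃ T, powTrace J p
        (M.fisherInfo x ((1 - t k) • lam + t k • Pi.single i 1)) = T := ⟨_, rfl⟩
      rw [hT] at hle hdual hself ⊢
      -- Optimality gives ψ(H) ≤ T, so the tangent inequality yields (p+1) T ≤ p tr(N H) + T.
      -- Subtracting (1-t) tr(N H) from T = tr(N H_t) then leaves t vᵀNv ≤ t T.
      have h1 : T ≤ trace (N * M.fisherInfo x lam) := by
        by_contra! hlt
        have := mul_lt_mul_of_pos_left hlt hp
        linarith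
      have h2 := mul_le_mul_of_nonneg_left h1 (sub_nonneg.mpr (ht1 k).le)
      have h3 : t k * (v ⬝ᵥ (N *ᵥ v)) ≤ t k * T := by linarith
      exact le_of_mul_le_mul_left h3 (ht0 k)
  · intro h mu hmu
    have hK := M.fisherInfo_posDef x hmu
    have hdual := add_one_mul_powTrace_le (J := J) hI hK hp
    have htr : trace (dualMatrix J p (M.fisherInfo x lam) * M.fisherInfo x mu)
        ≤ powTrace J p (M.fisherInfo x lam) := by
      rw [trace_mul_fisherInfo]
      calc _ ≤ ∑ i, mu i * powTrace J p (M.fisherInfo x lam) :=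
            Finset.sum_le_sum fun i _ => mul_le_mul_of_nonneg_left (h i) (hmu.1.1 i)
        _ = _ := by rw [← Finset.sum_mul, hmu.1.2, one_mul]
    have := mul_le_mul_of_nonneg_left htr hp.le
    show powTrace J p (M.fisherInfo x lam) ≤ powTrace J p (M.fisherInfo x mu)
    linarith

/-- If the sensitivities are bounded by the criterion, they are equal to it on the support. -/
theorem eq_powTrace_of_forall_le (J : Matrix (Fin q) (Fin l) ℝ) {p : ℝ} (hp : 0 < p)
    {lam : Fin n → ℝ} (hlam : lam ∈ M.feasibleWeights x)
    (h : ∀ i, M.w (x i) *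
        (M.basis (x i) ⬝ᵥ (dualMatrix J p (M.fisherInfo x lam) *ᵥ M.basis (x i)))
      ≤ powTrace J p (M.fisherInfo x lam)) {i : Fin n} (hi : 0 < lam i) :
    M.w (x i) * (M.basis (x i) ⬝ᵥ (dualMatrix J p (M.fisherInfo x lam) *ᵥ M.basis (x i)))
      = powTrace J p (M.fisherInfo x lam) := by
  have hself := trace_dualMatrix_mul_self (J := J) (M.fisherInfo_posDef x hlam) hp
  rw [trace_mul_fisherInfo] at hself
  have hsum : ∑ j, lam j * powTrace J p (M.fisherInfo x lam)
      = powTrace J p (M.fisherInfo x lam) := by rw [← Finset.sum_mul, hlam.1.2, one_mul]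
  have heq := (Finset.sum_eq_sum_iff_of_le fun j _ =>
    mul_le_mul_of_nonneg_left (h j) (hlam.1.1 j)).mp (hself.trans hsum.symm) i (Finset.mem_univ i)
  exact mul_left_cancel₀ hi.ne' heq

theorem Phi_eq (f : (Fin l → ℝ) → Fin q → ℝ) {p : ℝ} {lam : Fin n → ℝ}
    (hlam : lam ∈ M.feasibleWeights x) :
    M.Phi f p x lam = (q : ℝ) ^ (-1 / p)
      * powTrace (jacobianMatrix f M.coeff) p (M.fisherInfo x lam) ^ (1 / p) := by
  have hq : (0 : ℝ) ≤ q := q.cast_nonneg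
  rw [Phi, ← powTrace, Real.mul_rpow (inv_nonneg.mpr hq)
    (powTrace_nonneg (M.fisherInfo_posDef x hlam)), Real.inv_rpow hq, ← Real.rpow_neg hq, neg_div]

theorem sensitivity_eq (f : (Fin l → ℝ) → Fin q → ℝ) {p : ℝ} (hp : 0 < p) {lam : Fin n → ℝ}
    (hlam : lam ∈ M.feasibleWeights x) (i : Fin n) :
    M.sensitivity f p x lam i = (q : ℝ) ^ (-1 / p)
      * powTrace (jacobianMatrix f M.coeff) p (M.fisherInfo x lam) ^ (1 / p - 1)
      * (M.w (x i) * (M.basis (x i) ⬝ᵥ (dualMatrix (jacobianMatrix f M.coeff) p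
          (M.fisherInfo x lam) *ᵥ M.basis (x i)))) := by
  have hI := M.fisherInfo_posDef x hlam
  rw [sensitivity, B, trace_matrixRpow_inv_mul _ hI hp, matrixRpow_inv_mul_sandwich _ hI,
    ← powTrace, ← dualMatrix]

end GLM

theorem theorem1 {d l q n : ℕ} (M : GLM d l)
    (x : Fin n → Fin d → ℝ) (hx_mem : ∀ i, x i ∈ M.region) (hx_inj : Function.Injective x)
    (f : (Fin l → ℝ) → Fin q → ℝ) (hf : DifferentiableAt ℝ f M.coeff)
    (hJ : jacobianMatrix f M.coeff ≠ 0)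
    (p : ℝ) (hp : 0 < p)
    (lam : Fin n → ℝ) (hlam : lam ∈ M.feasibleWeights x) :
    IsMinOn (M.Phi f p x) (M.feasibleWeights x) lam ↔
      (∀ i, 0 < lam i → M.Phi f p x lam = M.sensitivity f p x lam i) ∧
      (∀ j, lam j = 0 → M.Phi f p x lam ≥ M.sensitivity f p x lam j) := by
  set J := jacobianMatrix f M.coeff with hJdef
  -- For q = 0 the matrix J would be empty, hence zero.
  have hq : 0 < (q : ℝ) := by
    rcases Nat.eq_zero_or_pos q with rfl | h
    · exact absurd (Subsingleton.elim J 0) hJ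
    · exact_mod_cast h
  have hqp : 0 < (q : ℝ) ^ (-1 / p) := Real.rpow_pos_of_pos hq _
  have hT : 0 < powTrace J p (M.fisherInfo x lam) := powTrace_pos hJ (M.fisherInfo_posDef x hlam)
  have hmin : IsMinOn (M.Phi f p x) (M.feasibleWeights x) lam ↔
      IsMinOn (fun mu => powTrace J p (M.fisherInfo x mu)) (M.feasibleWeights x) lam := by
    refine forall₂_congr fun mu hmu => ?_
    simp only [Set.mem_ofPred_eq]
    rw [M.Phi_eq x f hlam, M.Phi_eq x f hmu, mul_le_mul_iff_right₀ hqp]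
    exact Real.rpow_le_rpow_iff hT.le (powTrace_nonneg (M.fisherInfo_posDef x hmu))
      (one_div_pos.mpr hp)
  obtain ⟨c, hc⟩ : ∃ c, c = (q : ℝ) ^ (-1 / p)
      * powTrace J p (M.fisherInfo x lam) ^ (1 / p - 1) := ⟨_, rfl⟩
  have hc0 : 0 < c := hc ▸ mul_pos hqp (Real.rpow_pos_of_pos hT _)
  have hPhi : M.Phi f p x lam = c * powTrace J p (M.fisherInfo x lam) := by
    rw [M.Phi_eq x f hlam, hc, mul_assoc, Real.rpow_sub_one hT.ne', div_mul_cancel₀ _ hT.ne']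
  rw [hmin, M.isMinOn_powTrace_iff x J hp hlam]
  simp only [M.sensitivity_eq x f hp hlam, hPhi, ← hJdef, ← hc, ge_iff_le,
    mul_le_mul_iff_right₀ hc0, mul_right_inj' hc0.ne']
  constructor
  · exact fun h => ⟨fun i hi => (M.eq_powTrace_of_forall_le x J hp hlam h hi).symm, fun j _ => h j⟩
  · rintro ⟨h1, h2⟩ i
    rcases (hlam.1.1 i).eq_or_lt with h | h
    · exact h2 i h.symm
    · exact (h1 i h).ge
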